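/- Let $\mathcal A$ be a (real or complex) Banach algebra with unit $1$ and Jacobson radical $\mathcal J(\mathcal A)$, and let $n\ge 1$ be an integer. For $a\in\mathcal A$ put $\mathrm{Comm}(a)=\{y\in\mathcal A: ya=ay\}$ and $\mathrm{Comm}^2(a)=\{x\in\mathcal A: xy=yx \text{ for all } y\in\mathrm{Comm}(a)\}$. An element $a\in\mathcal A$ is called pseudo $n$-strong Drazin invertible (p$n$s-Drazin invertible), written $a\in\mathcal A^{pnsD}$, if there is $x\in\mathcal A$ such that $$x\in\mathrm{Comm}^2(a),\qquad xax=x,\qquad (a^n-ax)^k\in\mathcal J(\mathcal A)\ \text{ for some integer } k\ge 1;$$ such an $x$ is called a p$n$s-Drazin inverse of $a$ (it is unique) and is denoted by $a^{pnsD}$. Let $a,b\in\mathcal A^{pnsD}$ satisfy $a^2b=aba$ and $ab^2=bab$. Then the following are equivalent: 1. $a+b\in\mathcal A^{pnsD}$; 2. $aa^{pnsD}(a+b)bb^{pnsD}\in\mathcal A^{pnsD}$; 3. $aa^{pnsD}(a+b)\in\mathcal A^{pnsD}$; 4. $(a+b)bb^{pnsD}\in\mathcal A^{pnsD}$. -/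

import Mathlib

/-- `x` is a pseudo `n`-strong Drazin inverse of `a`: `x` lies in the double commutant of `a`,
`x * a * x = x`, and some positive power of `a ^ n - a * x` lies in the Jacobson radical. -/
structure IsPnsDrazinInverse {A : Type*} [Ring A] (n : ℕ) (a x : A) : Prop where
  mem_double_commutant : x ∈ Set.centralizer (Set.centralizer {a})
  mul_mul_self : x * a * x = x
  pow_mem_jacobson : ∃ k : ℕ, 0 < k ∧ (a ^ n - a * x) ^ k ∈ Ring.jacobson A

/-- `a` is pseudo `n`-strong Drazin invertible. -/
def IsPnsDrazinInvertible {A : Type*} [Ring A] (n : ℕ) (a : A) : Prop :=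
  ∃ x : A, IsPnsDrazinInverse n a x

/-! Write f(X) = X - X^(n+1) and J for the Jacobson radical. The key is `isPnsDrazinInvertible_iff`:
a is pns-Drazin invertible iff f(a) is nilpotent modulo J. For the converse direction, an idempotent
near a^n is built in the commutative Banach algebra Comm²(a), using an inverse square root. The
theorem then concerns nilpotency in A/J. There u = ab commutes with a, b and both Drazin inverses,
so u may be taken central. A power of u absorbs the idempotents p = a·aD and q = b·bD, so it has the
same product with all four elements; modulo u, where ab = 0, f is nilpotent at each of them.
`isNilpotent_sub_pow_succ_of_central` glues the two facts. -/

/-! ### Idempotents in commutative Banach algebras -/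

/-- If `1 - s • t` is invertible for every real `s`, then `1 - t` has an inverse square root of the
form `1 + t * g`. It is obtained as `exp (∫ s in 0..1, (1 / 2) • t * (1 - s • t)⁻¹)`. -/
theorem exists_one_add_mul_sq_mul_one_sub_eq_one {B : Type*} [NormedCommRing B]
    [NormedAlgebra ℝ B] [CompleteSpace B] (t : B) (ht : ∀ s : ℝ, IsUnit (1 - s • t)) :
    ∃ g : B, (1 + t * g) ^ 2 * (1 - t) = 1 := by
  set φ : ℝ → B := fun s => Ring.inverse (1 - s • t) with hφ
  have hφc : Continuous φ := by
    rw [continuous_iff_continuousAt]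
    intro s
    have h1 : ContinuousAt Ring.inverse (1 - s • t) :=
      NormedRing.inverse_continuousAt (ht s).unit
    exact ContinuousAt.comp (f := fun s : ℝ => 1 - s • t) h1 (by fun_prop)
  have hφm (s : ℝ) : φ s * (1 - s • t) = 1 := Ring.inverse_mul_cancel _ (ht s)
  set ψ : ℝ → B := fun s => (1 / 2 : ℝ) • (t * φ s) with hψ
  have hψc : Continuous ψ := by fun_prop
  set E : ℝ → B := fun r => NormedSpace.exp (∫ s in (0 : ℝ)..r, ψ s) with hE
  have hE' (r : ℝ) : HasDerivAt E (E r * ψ r) r := by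
    have h1 : HasDerivAt (fun r => ∫ s in (0 : ℝ)..r, ψ s) (ψ r) r :=
      intervalIntegral.integral_hasDerivAt_right (hψc.intervalIntegrable _ _)
        (hψc.stronglyMeasurableAtFilter _ _) hψc.continuousAt
    have h2 := (hasFDerivAt_exp (𝕂 := ℝ) (x := ∫ s in (0 : ℝ)..r, ψ s)).comp_hasDerivAt
      r h1
    exact h2.congr_deriv (by simp [hE])
  have hE0 : E 0 = 1 := by simp [hE]
  have hEc : Continuous E := continuous_iff_continuousAt.2 fun r => (hE' r).continuousAt
  -- E² (1 - r t) is constant: 2ψ = tφ cancels the derivative -t.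
  have hF (r : ℝ) : HasDerivAt (fun r : ℝ => E r * E r * (1 - r • t)) 0 r := by
    have h1 : HasDerivAt (fun r : ℝ => 1 - r • t) (-t) r := by
      simpa using ((hasDerivAt_id r).smul_const t).const_sub 1
    refine (((hE' r).mul (hE' r)).mul h1).congr_deriv ?_
    have h2 : ψ r + ψ r = t * φ r := by
      simp only [hψ, ← add_smul]; norm_num
    simp only [Pi.mul_apply]
    linear_combination (E r * E r * (1 - r • t)) * h2 + E r * E r * t * hφm r
  have hconst : E 1 * E 1 * (1 - (1 : ℝ) • t) = E 0 * E 0 * (1 - (0 : ℝ) • t) :=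
    is_const_of_deriv_eq_zero (fun r => (hF r).differentiableAt) (fun r => (hF r).deriv) 1 0
  -- The integrand is a multiple of t, hence so is E 1 - 1; this produces g.
  have hint : ∫ s in (0 : ℝ)..1, E s * ψ s = E 1 - E 0 :=
    intervalIntegral.integral_eq_sub_of_hasDerivAt (fun r _ => hE' r)
      ((hEc.mul hψc).intervalIntegrable _ _)
  have hcont : Continuous fun s => E s * ((1 / 2 : ℝ) • φ s) := by fun_prop
  have hfac : ∫ s in (0 : ℝ)..1, E s * ψ s
      = t * ∫ s in (0 : ℝ)..1, E s * ((1 / 2 : ℝ) • φ s) := by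
    have h := (ContinuousLinearMap.mul ℝ B t).intervalIntegral_comp_comm
      (hcont.intervalIntegrable (μ := MeasureTheory.volume) 0 1)
    simp only [ContinuousLinearMap.mul_apply'] at h
    rw [← h]
    congr 1
    ext s
    simp only [hψ, mul_smul_comm]
    congr 1
    ring
  refine ⟨∫ s in (0 : ℝ)..1, E s * ((1 / 2 : ℝ) • φ s), ?_⟩
  rw [← hfac, hint, hE0, add_sub_cancel, sq]
  simpa [hE0] using hconst

/-- An element `e` of a commutative real Banach algebra for which `1 - s • (e - e ^ 2)` is always
invertible differs from an idempotent by a multiple of `e - e ^ 2`. -/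
theorem exists_isIdempotentElem_eq_add_mul {B : Type*} [NormedCommRing B]
    [NormedAlgebra ℝ B] [CompleteSpace B] (e : B)
    (he : ∀ s : ℝ, IsUnit (1 - s • (e - e ^ 2))) :
    ∃ p g : B, IsIdempotentElem p ∧ p = e + (e - e ^ 2) * g := by
  -- Since (2e - 1)² = 1 - 4(e - e²), the element w = (2e - 1)(1 + 4(e - e²)g) squares to 1, and p =
  -- (1 + w)/2.
  obtain ⟨g, hg⟩ := exists_one_add_mul_sq_mul_one_sub_eq_one ((4 : ℝ) • (e - e ^ 2))
    fun s => by simpa [smul_smul] using he (s * 4)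
  obtain ⟨h, h2⟩ : ∃ h : B, 2 * h = 1 :=
    ⟨algebraMap ℝ B (1 / 2), by
      rw [← map_ofNat (algebraMap ℝ B) 2, ← map_mul]; norm_num⟩
  have h4 : (4 : ℝ) • (e - e ^ 2) = 4 * (e - e ^ 2) := by
    rw [Algebra.smul_def, map_ofNat]
  rw [h4] at hg
  refine ⟨e + (e - e ^ 2) * (2 * (2 * e - 1) * g), _, ?_, rfl⟩
  have h2p : e + (e - e ^ 2) * (2 * (2 * e - 1) * g)
      = h * (1 + (2 * e - 1) * (1 + 4 * (e - e ^ 2) * g)) := by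
    linear_combination (-e - (e - e ^ 2) * (2 * (2 * e - 1) * g)) * h2
  rw [IsIdempotentElem, h2p]
  linear_combination (h ^ 2) * hg + (h * (1 + (2 * e - 1) * (1 + 4 * (e - e ^ 2) * g))) * h2

/-! ### Units and the Jacobson radical -/

/-- In a (possibly noncommutative) ring, `1 + j` is a unit for `j` in the Jacobson radical. -/
theorem isUnit_one_add_of_mem_ringJacobson {A : Type*} [Ring A] {j : A}
    (hj : j ∈ Ring.jacobson A) : IsUnit (1 + j) := by
  have key (i : A) (hi : i ∈ Ring.jacobson A) : ∃ s, s * (1 + i) = 1 := by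
    rw [← Ideal.jacobson_bot] at hi
    obtain ⟨s, hs⟩ := Ideal.exists_mul_add_sub_mem_of_mem_jacobson _ hi
    exact ⟨s, by rw [add_comm 1 i]; exact sub_eq_zero.1 hs⟩
  obtain ⟨s, hs⟩ := key j hj
  -- The left inverse s equals 1 - sj, so it has a left inverse too.
  obtain ⟨r, hr⟩ := key (-(s * j)) (neg_mem (Ideal.mul_mem_left _ _ hj))
  have hs' : 1 + -(s * j) = s := by rw [← sub_eq_add_neg, sub_eq_iff_eq_add, ← hs]; noncomm_ring
  rw [hs'] at hr
  have hrj : r = 1 + j := left_inv_eq_right_inv hr hs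
  exact ⟨⟨1 + j, s, by rw [← hrj, hr], hs⟩, rfl⟩

/-- If a power of `y` lies in the Jacobson radical, then `1 - y` is a unit. -/
theorem isUnit_one_sub_of_pow_mem_ringJacobson {A : Type*} [Ring A] {y : A} {k : ℕ}
    (hy : y ^ k ∈ Ring.jacobson A) : IsUnit (1 - y) := by
  have h : (1 - y) * ∑ i ∈ Finset.range k, y ^ i = 1 + -y ^ k := by
    rw [mul_neg_geom_sum, sub_eq_add_neg]
  have hc : Commute (1 - y) (∑ i ∈ Finset.range k, y ^ i) :=
    Commute.sum_right _ _ _ fun i _ => ((Commute.one_left y).sub_left (Commute.refl y)).pow_right i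
  exact (hc.isUnit_mul_iff.1 (h ▸ isUnit_one_add_of_mem_ringJacobson (neg_mem hy))).1

/-- Centralizers are inverse closed. -/
theorem isUnit_of_isUnit_coe_centralizer {R A : Type*} [CommSemiring R] [Ring A] [Algebra R A]
    {s : Set A} {y : Subalgebra.centralizer R s} (hy : IsUnit (y : A)) : IsUnit y := by
  obtain ⟨v, hv⟩ := hy
  have hmem : (↑v⁻¹ : A) ∈ Subalgebra.centralizer R s := by
    rw [Subalgebra.mem_centralizer_iff]
    intro z hz
    have : Commute z (v : A) := by
      rw [hv]; exact (Subalgebra.mem_centralizer_iff R).1 y.2 z hz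
    exact this.units_inv_right
  exact ⟨⟨y, ⟨_, hmem⟩, Subtype.ext (by simp [← hv]), Subtype.ext (by simp [← hv])⟩, rfl⟩

/-! ### Invertibility as nilpotency of a - a^(n+1) -/

/-- If `a ^ n` is equal to an idempotent up to a nilpotent, the complementary
idempotent annihilates a power of `a`. -/
theorem exists_pow_mul_one_sub_eq_zero {R : Type*} [Ring R] {n : ℕ} {a p : R}
    (hap : Commute a p) (hp : IsIdempotentElem p) (h : IsNilpotent (a ^ n - p)) :
    ∃ m, a ^ m * (1 - p) = 0 := by
  obtain ⟨k, hk⟩ := h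
  refine ⟨n * k, ?_⟩
  have hc : Commute (a ^ n - p) (1 - p) :=
    ((Commute.one_right _).sub_right ((hap.pow_left n).sub_left (Commute.refl p)))
  have e : a ^ n * (1 - p) = (a ^ n - p) * (1 - p) := by
    rw [sub_mul, hp.mul_one_sub_self, sub_zero]
  have key (j : ℕ) : (a ^ n) ^ j * (1 - p) = (a ^ n - p) ^ j * (1 - p) := by
    induction j with
    | zero => simp
    | succ j ih =>
      rw [pow_succ, mul_assoc, e, hc.eq, ← mul_assoc, ih, mul_assoc, ← hc.eq, ← mul_assoc,
        ← pow_succ]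
  rw [pow_mul, key, hk, zero_mul]

/-- a - a^(n+1) = a(1 - p) - a(a^n - p) is a difference of commuting nilpotents. -/
theorem isNilpotent_sub_pow_succ {R : Type*} [Ring R] {n : ℕ} {a p : R}
    (hap : Commute a p) (hp : IsIdempotentElem p) (h : IsNilpotent (a ^ n - p)) :
    IsNilpotent (a - a ^ (n + 1)) := by
  obtain ⟨m, hm⟩ := exists_pow_mul_one_sub_eq_zero hap hp h
  have hq : Commute a (1 - p) := (Commute.one_right a).sub_right hap
  have haw : Commute a (a ^ n - p) := ((Commute.refl a).pow_right n).sub_right hap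
  have h1 : IsNilpotent (a * (1 - p)) := by
    refine ⟨m + 1, ?_⟩
    rw [hq.mul_pow, hp.one_sub.pow_succ_eq, pow_succ', mul_assoc, hm, mul_zero]
  have h2 : IsNilpotent (a * (a ^ n - p)) := haw.isNilpotent_mul_left h
  have hc : Commute (a * (1 - p)) (a * (a ^ n - p)) :=
    ((Commute.refl a).mul_right haw).mul_left
      ((hq.symm).mul_right ((hq.symm.pow_right n).sub_right
        ((Commute.one_left p).sub_left (Commute.refl p))))
  have e : a - a ^ (n + 1) = a * (1 - p) - a * (a ^ n - p) := by
    rw [pow_succ']; noncomm_ring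
  rw [e]
  exact hc.isNilpotent_sub h1 h2

theorem isNilpotent_mk_iff {A : Type*} [Ring A] (I : Ideal A) [I.IsTwoSided] (x : A) :
    IsNilpotent (Ideal.Quotient.mk I x) ↔ ∃ k, x ^ k ∈ I := by
  simp only [IsNilpotent, ← map_pow, Ideal.Quotient.eq_zero_iff_mem]

namespace IsPnsDrazinInverse

variable {A : Type*} [Ring A] {n : ℕ} {a x : A}

theorem commute_of_commute (h : IsPnsDrazinInverse n a x) {y : A} (hy : Commute a y) :
    Commute x y :=
  (h.mem_double_commutant y fun z hz => by rw [Set.mem_singleton_iff.1 hz]; exact hy).symm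

theorem commute (h : IsPnsDrazinInverse n a x) : Commute x a :=
  h.commute_of_commute (Commute.refl a)

theorem isIdempotentElem_mul (h : IsPnsDrazinInverse n a x) : IsIdempotentElem (a * x) := by
  rw [IsIdempotentElem, mul_assoc, ← mul_assoc x, h.mul_mul_self]

theorem isNilpotent_mk (h : IsPnsDrazinInverse n a x) :
    IsNilpotent (Ideal.Quotient.mk (Ring.jacobson A) (a ^ n - a * x)) :=
  let ⟨k, _, hk⟩ := h.pow_mem_jacobson
  (isNilpotent_mk_iff _ _).2 ⟨k, hk⟩

theorem isNilpotent_mk_sub_pow_succ (h : IsPnsDrazinInverse n a x) :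
    IsNilpotent (Ideal.Quotient.mk (Ring.jacobson A) (a - a ^ (n + 1))) := by
  set π := Ideal.Quotient.mk (Ring.jacobson A)
  have h1 : Commute (π a) (π (a * x)) := ((Commute.refl a).mul_right h.commute.symm).map π
  have h2 := h.isNilpotent_mk
  rw [map_sub, map_pow] at h2 ⊢
  exact isNilpotent_sub_pow_succ h1 (h.isIdempotentElem_mul.map π) h2

end IsPnsDrazinInverse

/-- In a real Banach algebra, `a` is pseudo `n`-strong Drazin invertible as soon as `a - a ^ (n + 1)`
is nilpotent modulo the Jacobson radical. -/
theorem isPnsDrazinInvertible_of_isNilpotent_mk {A : Type*} [NormedRing A] [NormedAlgebra ℝ A]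
    [CompleteSpace A] {n : ℕ} (hn : 1 ≤ n) {a : A}
    (h : IsNilpotent (Ideal.Quotient.mk (Ring.jacobson A) (a - a ^ (n + 1)))) :
    IsPnsDrazinInvertible n a := by
  obtain ⟨k, hk⟩ := (isNilpotent_mk_iff _ _).1 h
  obtain ⟨n, rfl⟩ := Nat.exists_eq_add_of_le' hn
  -- The double commutant is commutative, closed and inverse closed, and a Drazin inverse must lie
  -- in it.
  let B := Subalgebra.centralizer ℝ (Set.centralizer {a})
  have ha : a ∈ B := (Subalgebra.mem_centralizer_iff ℝ).2 fun z hz => (hz a rfl).symm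
  have hcomm (y z : B) : y * z = z * y := by
    refine Subtype.ext (z.2 y fun w hw => ?_)
    rw [Set.mem_singleton_iff.1 hw]
    exact y.2 a fun w hw => by rw [Set.mem_singleton_iff.1 hw]
  let _ : NormedCommRing B := { (inferInstance : NormedRing B) with mul_comm := hcomm }
  have : CompleteSpace B :=
    (Set.isClosed_centralizer (Set.centralizer {a})).completeSpace_coe
  let α : B := ⟨a, ha⟩
  have hJ (y : B) : ((α - α ^ (n + 2)) * y : B) ^ k ∈ (Ring.jacobson A).comap B.val := by
    rw [mul_pow, mul_comm, Ideal.mem_comap, map_mul]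
    exact Ideal.mul_mem_left _ _ hk
  have hunit (y : B) : IsUnit (1 - (α - α ^ (n + 2)) * y) :=
    isUnit_of_isUnit_coe_centralizer (isUnit_one_sub_of_pow_mem_ringJacobson (hJ y))
  obtain ⟨p, g, hp, hpg⟩ := exists_isIdempotentElem_eq_add_mul (α ^ (n + 1)) fun s => by
    have := hunit (s • α ^ n)
    convert this using 2
    rw [mul_smul_comm]
    congr 1
    ring
  have hw : α ^ (n + 1) - p = (α - α ^ (n + 2)) * (-(α ^ n * g)) := by
    rw [hpg]; ring
  -- v = α^(n+1) p + (1 - p), so x = α^n p v⁻¹ inverts α on the corner of p.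
  obtain ⟨v, hv⟩ := hunit (α ^ n * g * p)
  have hv' : (v : B) = 1 + (α ^ (n + 1) - p) * p := by rw [hv, hw]; ring
  have hpp : p * p = p := hp
  obtain ⟨x, hax, hxax⟩ : ∃ x : B, α * x = p ∧ x * α * x = x := by
    have h1 : α * (α ^ n * p) = p * v := by
      rw [hv']; linear_combination (1 - α ^ (n + 1) + p) * hpp
    have h2 : α * (α ^ n * p * ↑v⁻¹) = p := by
      rw [← mul_assoc, h1, Units.mul_inv_cancel_right]
    refine ⟨α ^ n * p * ↑v⁻¹, h2, ?_⟩
    rw [mul_assoc, h2]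
    linear_combination (α ^ n * ↑v⁻¹) * hpp
  refine ⟨x, x.2, congrArg Subtype.val hxax, k + 1, k.succ_pos, ?_⟩
  have h1 : a ^ (n + 1) - a * (x : A) = ((α ^ (n + 1) - p : B) : A) := by rw [← hax]; rfl
  rw [h1, hw, pow_succ']
  exact Ideal.mul_mem_left _ _ (hJ _)

theorem isPnsDrazinInvertible_iff {A : Type*} [NormedRing A] [NormedAlgebra ℝ A]
    [CompleteSpace A] {n : ℕ} (hn : 1 ≤ n) {a : A} :
    IsPnsDrazinInvertible n a ↔
      IsNilpotent (Ideal.Quotient.mk (Ring.jacobson A) (a - a ^ (n + 1))) :=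
  ⟨fun ⟨_, hx⟩ => hx.isNilpotent_mk_sub_pow_succ, isPnsDrazinInvertible_of_isNilpotent_mk hn⟩

/-! ### Nilpotency at a sum -/

/-- Factors x become y one at a time, z moving past the powers of y already produced; z need not
commute with x. -/
theorem mul_pow_eq_mul_pow {R : Type*} [Monoid R] {x y z : R} (hz : Commute z y)
    (h : z * x = z * y) (k : ℕ) : z * x ^ k = z * y ^ k := by
  induction k with
  | zero => simp
  | succ k ih =>
    rw [pow_succ, ← mul_assoc, ih, (hz.pow_right k).eq, mul_assoc, h, ← mul_assoc,
      ← (hz.pow_right k).eq, mul_assoc, ← pow_succ]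

theorem pow_mul_eq_pow_mul {R : Type*} [Monoid R] {x y z : R} (hz : Commute z y)
    (h : x * z = y * z) (k : ℕ) : x ^ k * z = y ^ k * z := by
  induction k with
  | zero => simp
  | succ k ih =>
    rw [pow_succ', mul_assoc, ih, ← (hz.pow_right k).eq, ← mul_assoc, h, mul_assoc,
      (hz.pow_right k).eq, ← mul_assoc, ← pow_succ']

theorem mul_sub_pow_pow_eq {R : Type*} [Ring R] {x y z : R} (hz : Commute z y)
    (h : z * x = z * y) (n k : ℕ) : z * (x - x ^ n) ^ k = z * (y - y ^ n) ^ k :=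
  mul_pow_eq_mul_pow (hz.sub_right (hz.pow_right n))
    (by rw [mul_sub, mul_sub, h, mul_pow_eq_mul_pow hz h]) k

theorem sub_pow_pow_mul_eq {R : Type*} [Ring R] {x y z : R} (hz : Commute z y)
    (h : x * z = y * z) (n k : ℕ) : (x - x ^ n) ^ k * z = (y - y ^ n) ^ k * z :=
  pow_mul_eq_pow_mul (hz.sub_right (hz.pow_right n))
    (by rw [sub_mul, sub_mul, h, pow_mul_eq_pow_mul hz h]) k

/-- If `a * b = 0` and `X - X ^ (n + 1)` is nilpotent at `a` and at `b`, then also at `a + b`. -/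
theorem isNilpotent_add_sub_pow_succ_of_mul_eq_zero {R : Type*} [Ring R] {n : ℕ} {a b : R}
    (hab : a * b = 0) (ha : IsNilpotent (a - a ^ (n + 1))) (hb : IsNilpotent (b - b ^ (n + 1))) :
    IsNilpotent ((a + b) - (a + b) ^ (n + 1)) := by
  obtain ⟨k, hk⟩ := ha
  obtain ⟨l, hl⟩ := hb
  set s := a + b with hs
  -- N exceeds k and l, and the extra 1 lets a factor s be split off F.
  set N := k + l + 1 with hN
  set F := (s - s ^ (n + 1)) ^ N with hF
  have haF : a * F = 0 := by
    rw [hF, mul_sub_pow_pow_eq (Commute.refl a) (by rw [hs, mul_add, hab, add_zero]),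
      pow_eq_zero_of_le (by omega) hk, mul_zero]
  have hFb : F * b = 0 := by
    rw [hF, sub_pow_pow_mul_eq (Commute.refl b) (by rw [hs, add_mul, hab, zero_add]),
      pow_eq_zero_of_le (by omega) hl, zero_mul]
  -- FsF = (Fb)F + F(aF) vanishes, and s divides F, so F³ = 0.
  have hFsF : F * s * F = 0 := by
    rw [hs, mul_add, hFb, add_zero, mul_assoc, haF, mul_zero]
  have hsF : Commute s F := ((Commute.refl s).sub_right (Commute.pow_right rfl _)).pow_right _
  have hfac : F = s * ((1 - s ^ n) * (s - s ^ (n + 1)) ^ (k + l)) := by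
    rw [hF, hN, pow_succ' _ (k + l), ← mul_assoc]
    congr 1
    rw [pow_succ', mul_sub, mul_one]
  refine ⟨N * 3, ?_⟩
  have hc : Commute F ((1 - s ^ n) * (s - s ^ (n + 1)) ^ (k + l)) := by
    refine Commute.mul_right ((Commute.one_right F).sub_right (hsF.symm.pow_right n)) ?_
    exact (hsF.symm.sub_right (hsF.symm.pow_right _)).pow_right _
  calc (s - s ^ (n + 1)) ^ (N * 3) = F * F * F := by rw [pow_mul, pow_three', ← hF]
    _ = F * s * (((1 - s ^ n) * (s - s ^ (n + 1)) ^ (k + l)) * F) := by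
      nth_rw 2 [hfac]; simp only [mul_assoc]
    _ = 0 := by rw [← hc.eq, ← mul_assoc, hFsF, zero_mul]

theorem isNilpotent_mul_sub_pow_succ {R : Type*} [Ring R] {n : ℕ} {a p : R}
    (hap : Commute a p) (hp : IsIdempotentElem p) (ha : IsNilpotent (a - a ^ (n + 1))) :
    IsNilpotent (a * p - (a * p) ^ (n + 1)) := by
  rw [hap.mul_pow, hp.pow_succ_eq, ← sub_mul]
  exact (hap.sub_left (hap.pow_left _)).isNilpotent_mul_right ha

/-- If `u` is central, `f = X - X ^ (n + 1)` is nilpotent at `x`, at `y` modulo `u`, and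
`u ^ m * x = u ^ m * y`, then `f` is nilpotent at `y`. -/
theorem isNilpotent_sub_pow_succ_of_central {R : Type*} [Ring R] {u : R}
    (hu : ∀ t, Commute u t) [(Ideal.span {u}).IsTwoSided] {n m : ℕ} {x y : R}
    (h : u ^ m * x = u ^ m * y) (hx : IsNilpotent (x - x ^ (n + 1)))
    (hy : IsNilpotent (Ideal.Quotient.mk (Ideal.span {u}) (y - y ^ (n + 1)))) :
    IsNilpotent (y - y ^ (n + 1)) := by
  obtain ⟨k, hk⟩ := hx
  obtain ⟨l, hl⟩ := (isNilpotent_mk_iff _ _).1 hy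
  obtain ⟨c, hc⟩ := Ideal.mem_span_singleton'.1 hl
  have h1 : u ^ m * (y - y ^ (n + 1)) ^ k = 0 := by
    rw [← mul_sub_pow_pow_eq ((hu y).pow_left m) h, hk, mul_zero]
  -- f(y)^l = cu gives f(y)^(lm) = c^m u^m, and u^m kills f(y)^k.
  refine ⟨l * m + k, ?_⟩
  rw [pow_add, pow_mul, ← hc, (hu c).symm.mul_pow, mul_assoc, h1, mul_zero]

/-- The idempotents `a * a'` and `b * b'` can be inserted into `a + b` without affecting nilpotency
of `X - X ^ (n + 1)` if `a * b` is central. -/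
theorem tfae_isNilpotent_of_central {R : Type*} [Ring R] {n : ℕ} {a b a' b' : R}
    (hu : ∀ t, Commute (a * b) t) (ha : Commute a' a) (hb : Commute b' b)
    (hp : IsIdempotentElem (a * a')) (hq : IsIdempotentElem (b * b'))
    (hna : IsNilpotent (a ^ n - a * a')) (hnb : IsNilpotent (b ^ n - b * b')) :
    List.TFAE [
      IsNilpotent ((a + b) - (a + b) ^ (n + 1)),
      IsNilpotent (a * a' * (a + b) * (b * b') - (a * a' * (a + b) * (b * b')) ^ (n + 1)),
      IsNilpotent (a * a' * (a + b) - (a * a' * (a + b)) ^ (n + 1)),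
      IsNilpotent ((a + b) * (b * b') - ((a + b) * (b * b')) ^ (n + 1))] := by
  have hap : Commute a (a * a') := (Commute.refl a).mul_right ha.symm
  have hbq : Commute b (b * b') := (Commute.refl b).mul_right hb.symm
  obtain ⟨i, hi⟩ := exists_pow_mul_one_sub_eq_zero hap hp hna
  obtain ⟨j, hj⟩ := exists_pow_mul_one_sub_eq_zero hbq hq hnb
  have hfa := isNilpotent_sub_pow_succ hap hp hna
  have hfb := isNilpotent_sub_pow_succ hbq hq hnb
  have hpow (m : ℕ) : (a * b) ^ m = a ^ m * b ^ m := by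
    induction m with
    | zero => simp
    | succ m ih =>
      rw [pow_succ, ← mul_assoc, ((hu a).pow_left m).eq, ih, pow_succ', pow_succ]
      simp only [mul_assoc]
  set u := a * b with hudef
  set p := a * a'
  set q := b * b'
  have hum (t : R) : Commute (u ^ (i + j)) t := (hu t).pow_left _
  -- u^(i+j) = a^(i+j) b^(i+j), where a^i kills 1 - p and b^j kills 1 - q.
  have hup : u ^ (i + j) * p = u ^ (i + j) := by
    have h0 : (1 - p) * u ^ (i + j) = 0 := by
      have h1 : Commute (a ^ (i + j)) (1 - p) := (Commute.one_right _).sub_right (hap.pow_left _)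
      rw [hpow, ← mul_assoc, ← h1.eq, add_comm i j, pow_add, mul_assoc (a ^ j), hi, mul_zero,
        zero_mul]
    rw [sub_mul, one_mul, sub_eq_zero] at h0
    rw [(hum p).eq, ← h0]
  have huq : u ^ (i + j) * q = u ^ (i + j) := by
    have h0 : u ^ (i + j) * (1 - q) = 0 := by
      rw [hpow, mul_assoc, pow_add b, mul_assoc, hj, mul_zero, mul_zero]
    rw [mul_sub, mul_one, sub_eq_zero] at h0
    exact h0.symm
  have hx₃ : u ^ (i + j) * (p * (a + b)) = u ^ (i + j) * (a + b) := by rw [← mul_assoc, hup]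
  have hx₄ (t : R) : u ^ (i + j) * (t * q) = u ^ (i + j) * t := by
    rw [← mul_assoc, (hum t).eq, mul_assoc, huq]
  have hx₂ : u ^ (i + j) * (p * (a + b) * q) = u ^ (i + j) * (a + b) := by rw [hx₄, hx₃]
  have : (Ideal.span {u}).IsTwoSided := ⟨fun t hs => by
    obtain ⟨c, rfl⟩ := Ideal.mem_span_singleton'.1 hs
    rw [mul_assoc, (hu t).eq, ← mul_assoc]
    exact Ideal.mul_mem_left _ _ (Ideal.mem_span_singleton_self u)⟩
  set π := Ideal.Quotient.mk (Ideal.span {u}) with hπ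
  have hπu : π a * π b = 0 := by
    rw [← map_mul]
    exact Ideal.Quotient.eq_zero_iff_mem.2 (Ideal.mem_span_singleton_self u)
  have hπp : π p * π b = 0 := by
    rw [show p = a' * a from ha.eq.symm, map_mul, mul_assoc, hπu, mul_zero]
  have hπq : π a * π q = 0 := by rw [map_mul π b b', ← mul_assoc, hπu, zero_mul]
  have hfa' : IsNilpotent (π a - π a ^ (n + 1)) := by simpa using hfa.map π
  have hfb' : IsNilpotent (π b - π b ^ (n + 1)) := by simpa using hfb.map π
  -- Modulo u the four elements become a + b with ab = 0, ap, bq and 0.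
  have h₁ : IsNilpotent (π ((a + b) - (a + b) ^ (n + 1))) := by
    simpa using isNilpotent_add_sub_pow_succ_of_mul_eq_zero hπu hfa' hfb'
  have h₃ : IsNilpotent (π (p * (a + b) - (p * (a + b)) ^ (n + 1))) := by
    have e : π (p * (a + b)) = π a * π p := by
      rw [map_mul, map_add, mul_add, hπp, add_zero, (hap.map π).eq]
    rw [map_sub, map_pow, e]
    exact isNilpotent_mul_sub_pow_succ (hap.map π) (hp.map π) hfa'
  have h₄ : IsNilpotent (π ((a + b) * q - ((a + b) * q) ^ (n + 1))) := by
    have e : π ((a + b) * q) = π b * π q := by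
      rw [map_mul, map_add, add_mul, hπq, zero_add]
    rw [map_sub, map_pow, e]
    exact isNilpotent_mul_sub_pow_succ (hbq.map π) (hq.map π) hfb'
  have h₂ : IsNilpotent (π (p * (a + b) * q - (p * (a + b) * q) ^ (n + 1))) := by
    have e : π (p * (a + b) * q) = 0 := by
      rw [map_mul, map_mul, map_add, mul_add, hπp, add_zero, mul_assoc, hπq, mul_zero]
    rw [map_sub, map_pow, e, zero_pow n.succ_ne_zero, sub_zero]
    exact IsNilpotent.zero
  refine List.tfae_of_forall (IsNilpotent ((a + b) - (a + b) ^ (n + 1))) _ ?_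
  simp only [List.mem_cons, List.not_mem_nil, or_false, forall_eq_or_imp, forall_eq]
  exact ⟨trivial,
    ⟨fun h => isNilpotent_sub_pow_succ_of_central hu hx₂ h h₁,
      fun h => isNilpotent_sub_pow_succ_of_central hu hx₂.symm h h₂⟩,
    ⟨fun h => isNilpotent_sub_pow_succ_of_central hu hx₃ h h₁,
      fun h => isNilpotent_sub_pow_succ_of_central hu hx₃.symm h h₃⟩,
    ⟨fun h => isNilpotent_sub_pow_succ_of_central hu (hx₄ _) h h₁,
      fun h => isNilpotent_sub_pow_succ_of_central hu (hx₄ _).symm h h₄⟩⟩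

/-- The same equivalence when `a * b` is only required to commute with `a`, `b`, `a'` and `b'`. -/
theorem tfae_isNilpotent {R : Type*} [Ring R] {n : ℕ} {a b a' b' : R}
    (hua : Commute (a * b) a) (hub : Commute (a * b) b)
    (hua' : Commute (a * b) a') (hub' : Commute (a * b) b')
    (ha : Commute a' a) (hb : Commute b' b)
    (hp : IsIdempotentElem (a * a')) (hq : IsIdempotentElem (b * b'))
    (hna : IsNilpotent (a ^ n - a * a')) (hnb : IsNilpotent (b ^ n - b * b')) :
    List.TFAE [
      IsNilpotent ((a + b) - (a + b) ^ (n + 1)),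
      IsNilpotent (a * a' * (a + b) * (b * b') - (a * a' * (a + b) * (b * b')) ^ (n + 1)),
      IsNilpotent (a * a' * (a + b) - (a * a' * (a + b)) ^ (n + 1)),
      IsNilpotent ((a + b) * (b * b') - ((a + b) * (b * b')) ^ (n + 1))] := by
  -- In this subring ab is central, and nilpotency does not depend on the ambient ring.
  let S := Subring.centralizer {a * b}
  have hmem {t : R} (ht : Commute (a * b) t) : t ∈ S :=
    Subring.mem_centralizer_iff.2 fun _ hg => by rw [Set.mem_singleton_iff.1 hg]; exact ht
  have hnil (t : S) : IsNilpotent t ↔ IsNilpotent (t : R) :=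
    (IsNilpotent.map_iff (f := S.subtype) Subtype.val_injective).symm
  have key := tfae_isNilpotent_of_central (R := S) (n := n) (a := ⟨a, hmem hua⟩)
    (b := ⟨b, hmem hub⟩) (a' := ⟨a', hmem hua'⟩) (b' := ⟨b', hmem hub'⟩)
    (fun t => Subtype.ext (Subring.mem_centralizer_iff.1 t.2 _ rfl))
    (Subtype.ext ha) (Subtype.ext hb) (Subtype.ext hp) (Subtype.ext hq)
    ((hnil _).2 hna) ((hnil _).2 hnb)
  simp only [hnil] at key
  exact key

theorem mainTheorem9 {𝕜 : Type*} [RCLike 𝕜] {A : Type*} [NormedRing A] [NormedAlgebra 𝕜 A]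
    [CompleteSpace A] (n : ℕ) (hn : 1 ≤ n) (a b aD bD : A)
    (ha : IsPnsDrazinInverse n a aD) (hb : IsPnsDrazinInverse n b bD)
    (hab : a ^ 2 * b = a * b * a) (hba : a * b ^ 2 = b * a * b) :
    List.TFAE [
      IsPnsDrazinInvertible n (a + b),
      IsPnsDrazinInvertible n (a * aD * (a + b) * (b * bD)),
      IsPnsDrazinInvertible n (a * aD * (a + b)),
      IsPnsDrazinInvertible n ((a + b) * (b * bD))] := by
  let _ : NormedAlgebra ℝ A := NormedAlgebra.restrictScalars ℝ 𝕜 A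
  -- The two relations say exactly that ab commutes with a and with b; the double commutant
  -- condition extends this to `aD` and `bD`.
  have hua : Commute (a * b) a := by
    rw [commute_iff_eq, ← hab, sq, mul_assoc]
  have hub : Commute (a * b) b := by
    rw [commute_iff_eq, mul_assoc, ← sq, hba, mul_assoc]
  set π := Ideal.Quotient.mk (Ring.jacobson A) with hπ
  have key := tfae_isNilpotent (n := n) (a := π a) (b := π b) (a' := π aD) (b' := π bD)
    (by simpa using hua.map π) (by simpa using hub.map π)
    (by simpa using (ha.commute_of_commute hua.symm).symm.map π)
    (by simpa using (hb.commute_of_commute hub.symm).symm.map π)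
    (ha.commute.map π) (hb.commute.map π)
    (by simpa using ha.isIdempotentElem_mul.map π) (by simpa using hb.isIdempotentElem_mul.map π)
    (by simpa using ha.isNilpotent_mk) (by simpa using hb.isNilpotent_mk)
  simp only [isPnsDrazinInvertible_iff hn]
  simpa only [map_sub, map_pow, map_mul, map_add] using key
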